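/- Let $d\in\mathbb N$ and $p,q\in[1,\infty]$. A \emph{moderate weight} on $\mathbb R^{2d}$ is a measurable function $m:\mathbb R^{2d}\to(0,\infty)$ that is even, $m(-z)=m(z)$, and for which there are constants $C,N>0$ with $m(x+y)\le C(1+\|x\|)^N m(y)$ for all $x,y\in\mathbb R^{2d}$, where $\|\cdot\|$ is the Euclidean norm. The space $L^{p,q}_m(\mathbb R^{2d})$ consists of the measurable functions $f:\mathbb R^d\times\mathbb R^d\to\mathbb C$ (modulo equality almost everywhere) with $$\|f\|_{p,q,m}=\big\|\,\omega\mapsto\|f(\cdot,\omega)\,m(\cdot,\omega)\|_{L^p(\mathbb R^d)}\big\|_{L^q(\mathbb R^d)}<\infty ,$$ and $L^{p,q}(\mathbb R^{2d})$ is the case $m\equiv1$. For $S\in\mathrm{Sp}(2d,\mathbb R)$ let $\mathcal D_S$ and $(\mathcal D_S)_m$ denote the map $f\mapsto f\circ S^{-1}$ considered on $L^{p,q}(\mathbb R^{2d})$ and on $L^{p,q}_m(\mathbb R^{2d})$, respectively. Such a map is called \emph{bounded} if it maps the space into itself and its norm is at most a constant multiple of the norm of the argument, and \emph{unbounded} if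 it is not bounded. Let $m$ be a moderate weight on $\mathbb R^{2d}$ and let $S\in\mathrm{Sp}(2d,\mathbb R)$. (a) If $\mathcal D_S$ is bounded on $L^{p,q}(\mathbb R^{2d})$, then $(\mathcal D_S)_m$ is bounded on $L^{p,q}_m(\mathbb R^{2d})$ if and only if $$\operatorname*{ess\,sup}_{z\in\mathbb R^{2d}}\frac{m(z)}{m(S^{-1}z)}<\infty .$$ (b) If $\mathcal D_S$ is unbounded on $L^{p,q}(\mathbb R^{2d})$ and $$\operatorname*{ess\,inf}_{z\in\mathbb R^{2d}}\frac{m(z)}{m(S^{-1}z)}>0,$$ then $(\mathcal D_S)_m$ is unbounded on $L^{p,q}_m(\mathbb R^{2d})$. -/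

import Mathlib

open MeasureTheory Matrix
open scoped ENNReal NNReal

namespace MixedNorm

/-- Phase space `ℝ²ᵈ`: the point `(x, ω)` is `Sum.elim x ω`, with `x` the first and `ω` the last
`d` coordinates. It carries Lebesgue measure as `volume`. -/
abbrev PhaseSpace (d : ℕ) : Type := Fin d ⊕ Fin d → ℝ

/-- A moderate weight on `ℝ²ᵈ`: a positive, Lebesgue measurable, even function `m` such that
`m (x + y) ≤ C (1 + ‖x‖) ^ N m y` for suitable `C, N > 0`, where `‖x‖` is the Euclidean norm. -/
structure IsModerateWeight {d : ℕ} (m : PhaseSpace d → ℝ) : Prop where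
  pos : ∀ z, 0 < m z
  aemeasurable : AEMeasurable m volume
  even : ∀ z, m (-z) = m z
  moderate : ∃ C N : ℝ, 0 < C ∧ 0 < N ∧ ∀ x y : PhaseSpace d,
    m (x + y) ≤ C * (1 + ‖WithLp.toLp 2 x‖) ^ N * m y

/-- The weighted mixed norm `‖f‖_{p,q,m} = ‖ω ↦ ‖f(·, ω) m(·, ω)‖_p‖_q`, with values
in `[0, ∞]`. -/
noncomputable def mixedNorm {d : ℕ} (p q : ℝ≥0∞) (m : PhaseSpace d → ℝ)
    (f : PhaseSpace d → ℂ) : ℝ≥0∞ :=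
  eLpNorm (fun ω : Fin d → ℝ =>
    eLpNorm (fun x : Fin d → ℝ => f (Sum.elim x ω) * (m (Sum.elim x ω) : ℂ)) p volume) q volume

/-- Membership in `L^{p,q}_m(ℝ²ᵈ)`: Lebesgue measurable with finite mixed norm. -/
def MemMixedLp {d : ℕ} (p q : ℝ≥0∞) (m : PhaseSpace d → ℝ) (f : PhaseSpace d → ℂ) : Prop :=
  AEStronglyMeasurable f volume ∧ mixedNorm p q m f < ∞

/-- The dilation `f ↦ f ∘ S⁻¹`. -/
noncomputable def dilation {d : ℕ} (S : Matrix (Fin d ⊕ Fin d) (Fin d ⊕ Fin d) ℝ)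
    (f : PhaseSpace d → ℂ) : PhaseSpace d → ℂ :=
  fun z => f (S⁻¹ *ᵥ z)

/-- The dilation `f ↦ f ∘ S⁻¹` is a bounded operator from `L^{p,q}_m(ℝ²ᵈ)` to itself: it maps the
space to itself, with a norm estimate. -/
def DilationBounded {d : ℕ} (p q : ℝ≥0∞) (m : PhaseSpace d → ℝ)
    (S : Matrix (Fin d ⊕ Fin d) (Fin d ⊕ Fin d) ℝ) : Prop :=
  ∃ C : ℝ≥0, ∀ f : PhaseSpace d → ℂ, MemMixedLp p q m f →
    MemMixedLp p q m (dilation S f) ∧ mixedNorm p q m (dilation S f) ≤ C * mixedNorm p q m f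

end MixedNorm

open Filter Metric

namespace MixedNorm

variable {d : ℕ} {p q : ℝ≥0∞}

/-! Multiplication by `m' / m` is an isometry from the `m'`-weighted space into the `m`-weighted
one. Moving the dilation across it costs the factor `m' z / m' (S⁻¹ z)` divided by `m z / m (S⁻¹
z)`, so an essential bound on this factor transfers boundedness
(`DilationBounded.of_weight_ratio_le`). The pair `1, m` gives sufficiency in (a), the pair `m, 1`
gives (b). For necessity in (a), test on the indicator of a unit ball about `S⁻¹ z`: a moderate
weight is comparable to a constant there, and unweighted norms of balls do not depend on the centre
(`DilationBounded.exists_weight_le`). Of `S`, only invertibility matters. -/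

theorem ae_ae_sumElim {P : PhaseSpace d → Prop} (h : ∀ᵐ z, P z) :
    ∀ᵐ ω : Fin d → ℝ, ∀ᵐ x : Fin d → ℝ, P (Sum.elim x ω) := by
  have e := ((volume_measurePreserving_sumPiEquivProdPi_symm (fun _ : Fin d ⊕ Fin d => ℝ)).comp
    Measure.measurePreserving_swap).quasiMeasurePreserving.ae h
  filter_upwards [Measure.ae_ae_of_ae_prod e] with ω hω
  filter_upwards [hω] with x hx
  convert hx using 1
  ext i
  cases i <;> rfl

theorem mixedNorm_le_mul_of_ae {m m' : PhaseSpace d → ℝ} {f g : PhaseSpace d → ℂ} {c : ℝ≥0}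
    (h : ∀ᵐ z, ‖f z * (m z : ℂ)‖ ≤ c * ‖g z * (m' z : ℂ)‖) :
    mixedNorm p q m f ≤ c * mixedNorm p q m' g := by
  refine eLpNorm_le_mul_eLpNorm_of_ae_le_mul' ?_ q
  filter_upwards [ae_ae_sumElim h] with ω hω
  simp only [enorm_eq_self]
  exact eLpNorm_le_nnreal_smul_eLpNorm_of_ae_le_mul hω p

theorem quasiMeasurePreserving_mulVec {ι : Type*} [Fintype ι] [DecidableEq ι] {A : Matrix ι ι ℝ}
    (hA : A.det ≠ 0) :
    Measure.QuasiMeasurePreserving (fun z : ι → ℝ => A *ᵥ z) volume volume :=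
  Measure.LinearMap.quasiMeasurePreserving volume (Matrix.toLin' A) (by simpa using hA)

/-- Boundedness of a dilation passes from one weight to another that grows at most as much
under the dilation. -/
theorem DilationBounded.of_weight_ratio_le {S : Matrix (Fin d ⊕ Fin d) (Fin d ⊕ Fin d) ℝ}
    (hS : S⁻¹.det ≠ 0) {m m' : PhaseSpace d → ℝ} (hm : ∀ z, 0 < m z) (hm' : ∀ z, 0 < m' z)
    (hmm : AEMeasurable m) (hmm' : AEMeasurable m') {K : ℝ≥0}
    (hK : ∀ᵐ z, m' z / m' (S⁻¹ *ᵥ z) ≤ K * (m z / m (S⁻¹ *ᵥ z)))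
    (h : DilationBounded p q m S) : DilationBounded p q m' S := by
  obtain ⟨C, hC⟩ := h
  refine ⟨K * C, fun f hf => ?_⟩
  set g : PhaseSpace d → ℂ := fun z => f z * ((m' z / m z : ℝ) : ℂ) with hg
  have hgm : ∀ z, g z * (m z : ℂ) = f z * (m' z : ℂ) := fun z => by
    have : (m z : ℂ) ≠ 0 := by exact_mod_cast (hm z).ne'
    simp only [hg, Complex.ofReal_div]
    field_simp
  have hnorm : mixedNorm p q m g = mixedNorm p q m' f := by
    simp only [mixedNorm, hgm]
  have hgL : MemMixedLp p q m g :=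
    ⟨hf.1.mul (Complex.measurable_ofReal.comp_aemeasurable
      (hmm'.div hmm)).aestronglyMeasurable, hnorm ▸ hf.2⟩
  obtain ⟨hD, hDC⟩ := hC g hgL
  -- Pointwise, the two weighted dilations differ exactly by the quotient of ratios that `hK`
  -- bounds.
  have key : mixedNorm p q m' (dilation S f) ≤ K * mixedNorm p q m (dilation S g) := by
    refine mixedNorm_le_mul_of_ae ?_
    filter_upwards [hK] with z hz
    have h1 := hm z
    have h2 := hm' z
    have h3 := hm (S⁻¹ *ᵥ z)
    have h4 := hm' (S⁻¹ *ᵥ z)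
    simp only [dilation, hg, norm_mul, Complex.norm_real, Real.norm_eq_abs, abs_div,
      abs_of_pos h1, abs_of_pos h2, abs_of_pos h3, abs_of_pos h4]
    rw [div_le_iff₀ h4] at hz
    calc _ ≤ ‖f (S⁻¹ *ᵥ z)‖ * (K * (m z / m (S⁻¹ *ᵥ z)) * m' (S⁻¹ *ᵥ z)) := by gcongr
      _ = _ := by ring
  refine ⟨⟨hf.1.comp_quasiMeasurePreserving (quasiMeasurePreserving_mulVec hS), ?_⟩, ?_⟩
  · exact key.trans_lt (ENNReal.mul_lt_top ENNReal.coe_lt_top hD.2)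
  · calc _ ≤ K * mixedNorm p q m (dilation S g) := key
      _ ≤ K * (C * mixedNorm p q m g) := by gcongr
      _ = _ := by rw [hnorm, ENNReal.coe_mul, mul_assoc]

/-- Sup-norm balls are products, so the mixed norm of their indicators factors. -/
theorem sumElim_mem_ball {w : PhaseSpace d} {r : ℝ} (hr : 0 < r) (x ω : Fin d → ℝ) :
    Sum.elim x ω ∈ ball w r ↔ x ∈ ball (w ∘ Sum.inl) r ∧ ω ∈ ball (w ∘ Sum.inr) r := by
  simp [dist_pi_lt_iff hr]

/-- The unweighted mixed norm of the indicator of a ball for the supremum norm. -/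
theorem mixedNorm_indicator_ball (hp : p ≠ 0) (hq : q ≠ 0) (w : PhaseSpace d) {r : ℝ}
    (hr : 0 < r) :
    mixedNorm p q (fun _ => 1) ((ball w r).indicator fun _ => 1) =
      volume (ball (0 : Fin d → ℝ) r) ^ (1 / p.toReal) *
        volume (ball (0 : Fin d → ℝ) r) ^ (1 / q.toReal) := by
  -- Nonzero measure lets one formula cover the exponent `∞`, where `1 / p.toReal = 0` and the
  -- factor is `1`.
  have hpos (v : Fin d → ℝ) : volume (ball v r) ≠ 0 := (measure_ball_pos volume v hr).ne'
  have hinner (ω : Fin d → ℝ) :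
      eLpNorm (fun x : Fin d → ℝ => (ball w r).indicator (fun _ => (1 : ℂ)) (Sum.elim x ω) *
        ((1 : ℝ) : ℂ)) p volume =
      (ball (w ∘ Sum.inr) r).indicator
        (fun _ => volume (ball (0 : Fin d → ℝ) r) ^ (1 / p.toReal)) ω := by
    by_cases hω : ω ∈ ball (w ∘ Sum.inr) r
    · have : (fun x : Fin d → ℝ => (ball w r).indicator (fun _ => (1 : ℂ)) (Sum.elim x ω) *
          ((1 : ℝ) : ℂ)) = (ball (w ∘ Sum.inl) r).indicator fun _ => (1 : ℂ) := by
        ext x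
        by_cases hx : x ∈ ball (w ∘ Sum.inl) r <;>
          simp only [Set.indicator, sumElim_mem_ball hr, hx, hω] <;> simp
      rw [this, eLpNorm_indicator_const' measurableSet_ball (hpos _) hp,
        Measure.addHaar_ball_center, Set.indicator_of_mem hω]
      simp
    · have : (fun x : Fin d → ℝ => (ball w r).indicator (fun _ => (1 : ℂ)) (Sum.elim x ω) *
          ((1 : ℝ) : ℂ)) = fun _ => 0 := by
        ext x
        simp only [Set.indicator, sumElim_mem_ball hr, hω, and_false, if_false, zero_mul]
      rw [this, Set.indicator_of_notMem hω, eLpNorm_zero']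
  simp only [mixedNorm, hinner]
  rw [eLpNorm_indicator_const' measurableSet_ball (hpos _) hq, enorm_eq_self,
    Measure.addHaar_ball_center volume (w ∘ Sum.inr)]

theorem IsModerateWeight.exists_le_mul_of_norm_le {m : PhaseSpace d → ℝ}
    (hm : IsModerateWeight m) (r : ℝ) :
    ∃ M : ℝ≥0, ∀ h w : PhaseSpace d, ‖h‖ ≤ r → m (h + w) ≤ M * m w := by
  obtain ⟨C, N, hC, hN, hCN⟩ := hm.moderate
  -- Moderateness is Euclidean, while `‖h‖` is the sup norm.
  obtain ⟨R, hR0, hR⟩ : ∃ R : ℝ, 0 ≤ R ∧ ∀ h : PhaseSpace d, ‖h‖ ≤ r → ‖WithLp.toLp 2 h‖ ≤ R := by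
    let L := ((PiLp.continuousLinearEquiv 2 ℝ fun _ : Fin d ⊕ Fin d => ℝ).symm :
      PhaseSpace d →L[ℝ] PiLp 2 fun _ : Fin d ⊕ Fin d => ℝ)
    refine ⟨‖L‖ * |r|, by positivity, fun h hh => ?_⟩
    exact (L.le_opNorm h).trans (by gcongr; exact hh.trans (le_abs_self r))
  have hpos : 0 < C * (1 + R) ^ N := by positivity
  refine ⟨(C * (1 + R) ^ N).toNNReal, fun h w hh => ?_⟩
  rw [Real.coe_toNNReal _ hpos.le]
  refine (hCN h w).trans ?_
  have := hm.pos w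
  have := hR h hh
  gcongr

/-- A bounded dilation on a weighted space controls the weight along the dilation. -/
theorem DilationBounded.exists_weight_le (hp : p ≠ 0) (hq : q ≠ 0) {m : PhaseSpace d → ℝ}
    (hm : IsModerateWeight m) {S : Matrix (Fin d ⊕ Fin d) (Fin d ⊕ Fin d) ℝ}
    (h : DilationBounded p q m S) :
    ∃ K : ℝ≥0, ∀ z, m z ≤ K * m (S⁻¹ *ᵥ z) := by
  obtain ⟨A, hA⟩ := h
  obtain ⟨M, hM⟩ := hm.exists_le_mul_of_norm_le 1
  -- For every `z`, the `ε`-ball about `z` is sent by `S⁻¹` into the unit ball about `S⁻¹ z`, so the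
  -- dilated indicator is `1` on it; `ε ≤ 1` keeps `M` usable.
  obtain ⟨ε, hε, hε1, hεS⟩ : ∃ ε : ℝ, 0 < ε ∧ ε ≤ 1 ∧
      ∀ h : PhaseSpace d, ‖h‖ < ε → ‖S⁻¹ *ᵥ h‖ < 1 := by
    have hc : ContinuousAt (fun h : PhaseSpace d => S⁻¹ *ᵥ h) 0 :=
      (Continuous.matrix_mulVec continuous_const continuous_id).continuousAt
    obtain ⟨δ, hδ, H⟩ := Metric.continuousAt_iff.1 hc 1 one_pos
    refine ⟨min δ 1, by positivity, min_le_right _ _, fun h hh => ?_⟩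
    simpa using H (x := h) (by simpa using hh.trans_le (min_le_left _ _))
  let B : ℝ → ℝ≥0∞ := fun r => volume (ball (0 : Fin d → ℝ) r) ^ (1 / p.toReal) *
    volume (ball (0 : Fin d → ℝ) r) ^ (1 / q.toReal)
  have hBall (v : PhaseSpace d) {r : ℝ} (hr : 0 < r) :
      mixedNorm p q (fun _ => 1) ((ball v r).indicator fun _ => 1) = B r :=
    mixedNorm_indicator_ball hp hq v hr
  have hBtop (r : ℝ) : B r ≠ ∞ := ENNReal.mul_ne_top
    (ENNReal.rpow_ne_top_of_nonneg (by positivity) measure_ball_lt_top.ne)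
    (ENNReal.rpow_ne_top_of_nonneg (by positivity) measure_ball_lt_top.ne)
  have hB0 : B ε ≠ 0 := mul_ne_zero
    (ENNReal.rpow_pos (measure_ball_pos _ _ hε) measure_ball_lt_top.ne).ne'
    (ENNReal.rpow_pos (measure_ball_pos _ _ hε) measure_ball_lt_top.ne).ne'
  refine ⟨M * M * A * (B 1 / B ε).toNNReal, fun z => ?_⟩
  set w : PhaseSpace d := S⁻¹ *ᵥ z with hw
  have hmz := hm.pos z
  have hmw := hm.pos w
  set f : PhaseSpace d → ℂ := (ball w 1).indicator fun _ => 1 with hf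
  have hupper : mixedNorm p q m f ≤ (M * (m w).toNNReal : ℝ≥0) * B 1 := by
    rw [← hBall w one_pos]
    refine mixedNorm_le_mul_of_ae (Eventually.of_forall fun y => ?_)
    by_cases hy : y ∈ ball w 1
    · have := hM (y - w) w (mem_ball_iff_norm.1 hy).le
      rw [sub_add_cancel] at this
      simpa [hf, hy, abs_of_pos (hm.pos y), hmw.le] using this
    · simp only [hf, Set.indicator_of_notMem hy]
      simp
  have hlower : B ε ≤ (M * (m z).toNNReal⁻¹ : ℝ≥0) * mixedNorm p q m (dilation S f) := by
    rw [← hBall z hε]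
    refine mixedNorm_le_mul_of_ae (Eventually.of_forall fun y => ?_)
    by_cases hy : y ∈ ball z ε
    · have hyz := mem_ball_iff_norm.1 hy
      have hSy : S⁻¹ *ᵥ y ∈ ball w 1 := by
        rw [mem_ball_iff_norm, hw, ← Matrix.mulVec_sub]
        exact hεS _ hyz
      have := hM (z - y) y (by rw [norm_sub_rev]; exact hyz.le.trans hε1)
      rw [sub_add_cancel] at this
      simp only [dilation, hf, Set.indicator_of_mem hy, Set.indicator_of_mem hSy]
      simp only [Complex.ofReal_one, mul_one, norm_one, one_mul, Complex.norm_real,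
        Real.norm_eq_abs, abs_of_pos (hm.pos y), NNReal.coe_mul, NNReal.coe_inv,
        Real.coe_toNNReal _ hmz.le]
      rw [mul_right_comm, ← div_eq_mul_inv, le_div_iff₀ hmz, one_mul]
      exact this
    · simp only [Set.indicator_of_notMem hy]
      simp only [zero_mul, norm_zero]
      positivity
  have hfL : MemMixedLp p q m f :=
    ⟨(stronglyMeasurable_const.indicator measurableSet_ball).aestronglyMeasurable,
      hupper.trans_lt (ENNReal.mul_lt_top ENNReal.coe_lt_top (hBtop 1).lt_top)⟩
  -- Solving this for `m z` gives the constant chosen above, independent of `z`.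
  have hchain : B ε ≤ ((M * (m z).toNNReal⁻¹) * (A * (M * (m w).toNNReal)) : ℝ≥0) * B 1 := by
    calc B ε ≤ _ := hlower
      _ ≤ (M * (m z).toNNReal⁻¹ : ℝ≥0) * (A * ((M * (m w).toNNReal : ℝ≥0) * B 1)) := by
        gcongr
        exact (hA f hfL).2.trans (by gcongr)
      _ = _ := by push_cast; ring
  have hreal := ENNReal.toReal_mono (ENNReal.mul_ne_top ENNReal.coe_ne_top (hBtop 1)) hchain
  have hBε : 0 < (B ε).toReal := ENNReal.toReal_pos hB0 (hBtop ε)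
  simp only [ENNReal.toReal_mul, ENNReal.coe_toReal, NNReal.coe_mul, NNReal.coe_inv,
    Real.coe_toNNReal _ hmz.le, Real.coe_toNNReal _ hmw.le] at hreal
  simp only [NNReal.coe_mul, ENNReal.coe_toNNReal_eq_toReal, ENNReal.toReal_div]
  rw [← mul_le_mul_iff_left₀ hBε]
  calc m z * (B ε).toReal
      ≤ m z * (M * (m z)⁻¹ * (A * (M * m w)) * (B 1).toReal) := by gcongr
    _ = _ := by field_simp

end MixedNorm

theorem mainTheorem4 (d : ℕ) (p q : ℝ≥0∞) (hp : 1 ≤ p) (hq : 1 ≤ q)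
    (m : MixedNorm.PhaseSpace d → ℝ) (hm : MixedNorm.IsModerateWeight m)
    (S : Matrix (Fin d ⊕ Fin d) (Fin d ⊕ Fin d) ℝ) (hS : S ∈ Matrix.symplecticGroup (Fin d) ℝ) :
    (MixedNorm.DilationBounded p q (fun _ => 1) S →
      (MixedNorm.DilationBounded p q m S ↔
        essSup (fun z : MixedNorm.PhaseSpace d => ENNReal.ofReal (m z / m (S⁻¹ *ᵥ z))) volume
          < ∞)) ∧
    (¬ MixedNorm.DilationBounded p q (fun _ => 1) S →
      0 < essInf (fun z : MixedNorm.PhaseSpace d => ENNReal.ofReal (m z / m (S⁻¹ *ᵥ z))) volume →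
      ¬ MixedNorm.DilationBounded p q m S) := by
  have hSu : IsUnit S.det := SymplecticGroup.symplectic_det hS
  have hSinv : S⁻¹.det ≠ 0 := (Matrix.isUnit_nonsing_inv_det S hSu).ne_zero
  have hratio (z : MixedNorm.PhaseSpace d) : 0 < m z / m (S⁻¹ *ᵥ z) :=
    div_pos (hm.pos _) (hm.pos _)
  refine ⟨fun h1 => ⟨fun h => ?_, fun hess => ?_⟩, fun h1 hess h => h1 ?_⟩
  · obtain ⟨K, hK⟩ := h.exists_weight_le (zero_lt_one.trans_le hp).ne'
      (zero_lt_one.trans_le hq).ne' hm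
    refine (essSup_le_of_ae_le (K : ℝ≥0∞) (Filter.Eventually.of_forall fun z => ?_)).trans_lt
      ENNReal.coe_lt_top
    exact ENNReal.ofReal_le_of_le_toReal (by simpa using (div_le_iff₀ (hm.pos _)).2 (hK z))
  · refine h1.of_weight_ratio_le hSinv (fun _ => one_pos) hm.pos aemeasurable_const
      hm.aemeasurable (K := (essSup (fun z : MixedNorm.PhaseSpace d =>
        ENNReal.ofReal (m z / m (S⁻¹ *ᵥ z))) volume).toNNReal) ?_
    filter_upwards [ENNReal.ae_le_essSup fun z : MixedNorm.PhaseSpace d =>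
      ENNReal.ofReal (m z / m (S⁻¹ *ᵥ z))] with z hz
    simpa [ENNReal.coe_toNNReal_eq_toReal] using (ENNReal.ofReal_le_iff_le_toReal hess.ne).1 hz
  -- The target weight `1` has ratio `1`, at most `c⁻¹` times any ratio exceeding `c`.
  · obtain ⟨c, hc0, hc⟩ := ENNReal.lt_iff_exists_nnreal_btwn.1 hess
    have hc0' : 0 < (c : ℝ) := by exact_mod_cast hc0
    refine h.of_weight_ratio_le hSinv hm.pos (fun _ => one_pos) hm.aemeasurable
      aemeasurable_const (K := c⁻¹) ?_
    filter_upwards [ae_lt_of_lt_essInf hc] with z hz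
    have : (c : ℝ) < m z / m (S⁻¹ *ᵥ z) := by
      rw [← ENNReal.ofReal_coe_nnreal] at hz
      exact (ENNReal.ofReal_lt_ofReal_iff (hratio z)).1 hz
    rw [NNReal.coe_inv, div_one, inv_mul_eq_div, le_div_iff₀ hc0', one_mul]
    exact this.le
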